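/- Let $G$ be a finite group and write $\mathrm{Set}^G$ for the category of finite $G$-sets. An *indexing category* $\mathcal O$ for $G$ is a wide, pullback stable, finite coproduct complete subcategory of $\mathrm{Set}^G$ (finite coproducts of $\mathrm{Set}^G$, with their inclusions, are also coproducts in $\mathcal O$). For $H\le G$, an $H$-set $X$ is *$\mathcal O$-admissible* if the canonical map $G\times_H X\to G/H$, $[g,x]\mapsto gH$, is in $\mathcal O$, and $i_H^*\mathcal O$ is the class of maps $f$ of finite $H$-sets such that $G\times_H f$ is in $\mathcal O$. A pair $(\mathcal O_m,\mathcal O_a)$ of indexing categories is *compatible* if for every $n\colon S\to T$ in $\mathcal O_m$ and every $p\colon A\to S$ in $\mathcal O_a$, the dependent product $n_*A\to T$ is in $\mathcal O_a$, where $n_*$ is the right adjoint of the pullback functor $n^*\colon \mathrm{Set}^G_{/T}\to\mathrm{Set}^G_{/S}$. For $K\le H\le G$ let $\mathrm{Map}_K(H,-)\colon \mathrm{Set}^K\to\mathrm{Set}^H$ be coinduction: $\mathrm{Map}_K(H,S)$ is the set of $K$-equivariant maps $\alpha\colon H\to S$ with $(x\alpha)(h)=\alpha(hx)$, and $\mathrm{Map}_K(H,f)(\alpha)=f\circ\alpha$.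 A *$G$-transfer system* $\mathcal T$ is a partial order $\le_{\mathcal T}$ on the subgroups of $G$ that refines inclusion and is closed under conjugation and under intersection with subgroups ($K\le_{\mathcal T}H$ implies $K\cap L\le_{\mathcal T}H\cap L$ for all $L\le G$). It *corresponds* to the indexing category $\mathcal O$ if, for all subgroups $K,H$ of $G$, $K\le_{\mathcal T}H$ holds exactly when $K\le H$ and $H/K$ is $\mathcal O$-admissible. A pair $(\mathcal T_1,\mathcal T_2)$ is *compatible* if $K\le_{\mathcal T_1}H$ implies $K\le_{\mathcal T_2}H$, and whenever $B,C\le A$ are subgroups of $G$ with $B\le_{\mathcal T_1}A$ and $B\cap C\le_{\mathcal T_2}B$, then $C\le_{\mathcal T_2}A$. **Claim.** Let $\mathcal O_m,\mathcal O_a$ be indexing categories for $G$. 1. If $(\mathcal O_m,\mathcal O_a)$ is compatible, then for all $K\le H\le G$ with $H/K$ $\mathcal O_m$-admissible, coinduction restricts to a functor $\mathrm{Map}_K(H,-)\colon i_K^*\mathcal O_a\to i_H^*\mathcal O_a$; that is, if $f$ is in $i_K^*\mathcal O_a$, then $\mathrm{Map}_K(H,f)$ is in $i_H^*\mathcal O_a$.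 2. If $\mathcal O_m,\mathcal O_a$ correspond to transfer systems $\mathcal T_m,\mathcal T_a$ such that $(\mathcal T_m,\mathcal T_a)$ is compatible, then for all $K\le H\le G$ with $H/K$ $\mathcal O_m$-admissible, $\mathrm{Map}_K(H,f)$ is in $i_H^*\mathcal O_a$ for every $f$ in $i_K^*\mathcal O_a$, and $\mathrm{Map}_K(H,S)$ is an $\mathcal O_a$-admissible $H$-set for every $\mathcal O_a$-admissible $K$-set $S$. Moreover $(\mathcal O_m,\mathcal O_a)$ is then compatible. -/

import Mathlib

open CategoryTheory CategoryTheory.Limits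
open scoped Pointwise

universe u

/-! The category of finite `G`-sets -/

/-- A finite `G`-set. -/
structure FinGSet (G : Type u) [Group G] : Type (u + 1) where
  carrier : Type u
  [action : MulAction G carrier]
  [finite : Finite carrier]

namespace FinGSet

attribute [instance] FinGSet.action FinGSet.finite

/-- A morphism of finite `G`-sets is a `G`-equivariant map. -/
@[ext]
structure Hom {G : Type u} [Group G] (X Y : FinGSet G) : Type u where
  hom : X.carrier →[G] Y.carrier

instance category (G : Type u) [Group G] : Category (FinGSet G) where
  Hom X Y := Hom X Y
  id X := ⟨MulActionHom.id G⟩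
  comp f g := ⟨g.hom.comp f.hom⟩

section Coset

variable {G : Type u} [Group G] [Finite G]

/-- The orbit `G/H` as a `G`-set. -/
def coset (H : Subgroup G) : FinGSet G where
  carrier := G ⧸ H

/-- For subgroups `K ≤ H` of `G`, the orbit `H/K` as an `H`-set. -/
def orbit (H K : Subgroup G) : FinGSet H where
  carrier := H ⧸ K.subgroupOf H

end Coset

section Induction

variable {G : Type u} [Group G]

/-- The relation `(g, x) ∼ (g h⁻¹, h x)`, for `h ∈ H`, on `G × X`. -/
def indSetoid (H : Subgroup G) (X : FinGSet H) : Setoid (G × X.carrier) where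
  r p q := ∃ h : H, q.1 = p.1 * (h : G)⁻¹ ∧ q.2 = h • p.2
  iseqv :=
    { refl := fun p => ⟨1, by simp⟩
      symm := by
        rintro ⟨g, x⟩ ⟨g', x'⟩ ⟨h, h1, h2⟩
        refine ⟨h⁻¹, ?_, ?_⟩
        · simp only at h1
          simp [h1]
        · simp only at h2
          simp [h2]
      trans := by
        rintro ⟨g, x⟩ ⟨g', x'⟩ ⟨g'', x''⟩ ⟨h, h1, h2⟩ ⟨k, k1, k2⟩
        refine ⟨k * h, ?_, ?_⟩
        · simp only at h1 k1
          simp [h1, k1, mul_assoc]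
        · simp only at h2 k2
          simp [h2, k2, mul_smul] }

/-- The underlying set of the induced `G`-set `G ×_H X`. -/
abbrev IndSet (H : Subgroup G) (X : FinGSet H) : Type u :=
  Quotient (indSetoid H X)

/-- `G` acts on `G ×_H X` by `g [g', x] = [g g', x]`. -/
instance indAction (H : Subgroup G) (X : FinGSet H) : MulAction G (IndSet H X) where
  smul g := Quotient.map (fun p => (g * p.1, p.2)) (by
    rintro ⟨a, x⟩ ⟨b, y⟩ ⟨h, h1, h2⟩
    refine ⟨h, ?_, h2⟩
    simp only at h1
    simp [h1, mul_assoc])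
  one_smul := by
    rintro ⟨a, x⟩
    exact congrArg (Quotient.mk (indSetoid H X)) (Prod.ext (one_mul a) rfl)
  mul_smul := by
    rintro g g' ⟨a, x⟩
    exact congrArg (Quotient.mk (indSetoid H X)) (Prod.ext (mul_assoc g g' a) rfl)

instance indFinite [Finite G] (H : Subgroup G) (X : FinGSet H) : Finite (IndSet H X) :=
  inferInstanceAs (Finite (Quotient (indSetoid H X)))

/-- The induction functor `G ×_H (-)` from finite `H`-sets to finite `G`-sets. -/
def ind [Finite G] (H : Subgroup G) : FinGSet H ⥤ FinGSet G where
  obj X := { carrier := IndSet H X }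
  map {X Y} f :=
    ⟨{ toFun := Quotient.map (fun p => (p.1, f.hom p.2)) (by
        rintro ⟨a, x⟩ ⟨b, y⟩ ⟨h, h1, h2⟩
        refine ⟨h, h1, ?_⟩
        simp only at h2
        simp [h2])
       map_smul' := by
        rintro g ⟨a, x⟩
        rfl }⟩
  map_id X := by
    apply Hom.ext
    ext ⟨a, x⟩
    rfl
  map_comp f g := by
    apply Hom.ext
    ext ⟨a, x⟩
    rfl

/-- The canonical `G`-map `G ×_H X ⟶ G/H`, `[g, x] ↦ g H`. -/
def indProj [Finite G] (H : Subgroup G) (X : FinGSet H) : (ind H).obj X ⟶ coset H :=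
  ⟨{ toFun := Quotient.lift (fun p : G × X.carrier => (QuotientGroup.mk p.1 : G ⧸ H)) (by
      rintro ⟨a, x⟩ ⟨b, y⟩ ⟨h, h1, h2⟩
      simp only at h1
      apply QuotientGroup.eq.2
      simp [h1])
     map_smul' := by
      rintro g ⟨a, x⟩
      rfl }⟩

end Induction

section Coinduction

variable {G : Type u} [Group G]

/-- The set `Map_K(H, S)` of `K`-equivariant maps `H → S`, where `K` acts on `H` by left
multiplication. -/
@[ext]
structure CoindSet {K H : Subgroup G} (hKH : K ≤ H) (S : FinGSet K) : Type u where
  toFun : H → S.carrier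
  map_mul : ∀ (k : K) (h : H), toFun (Subgroup.inclusion hKH k * h) = k • toFun h

/-- `H` acts on `Map_K(H, S)` by `(x α)(h) = α (h x)`. -/
instance coindAction {K H : Subgroup G} (hKH : K ≤ H) (S : FinGSet K) :
    MulAction H (CoindSet hKH S) where
  smul x α :=
    { toFun := fun h => α.toFun (h * x)
      map_mul := fun k h => by rw [mul_assoc, α.map_mul] }
  one_smul α := CoindSet.ext (funext fun h => congrArg α.toFun (mul_one h))
  mul_smul x y α := CoindSet.ext (funext fun h => congrArg α.toFun (mul_assoc h x y).symm)

instance coindFinite [Finite G] {K H : Subgroup G} (hKH : K ≤ H) (S : FinGSet K) :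
    Finite (CoindSet hKH S) :=
  Finite.of_injective CoindSet.toFun fun _ _ h => CoindSet.ext h

/-- The coinduction functor `Map_K(H, -)` from finite `K`-sets to finite `H`-sets; it sends `f`
to `α ↦ f ∘ α`. -/
def coind [Finite G] {K H : Subgroup G} (hKH : K ≤ H) : FinGSet K ⥤ FinGSet H where
  obj S := { carrier := CoindSet hKH S }
  map {S T} f :=
    ⟨{ toFun := fun α : CoindSet hKH S =>
        ({ toFun := fun h => f.hom (α.toFun h)
           map_mul := fun k h => by rw [α.map_mul, map_smul] } : CoindSet hKH T)
       map_smul' := fun _ _ => rfl }⟩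
  map_id _ := rfl
  map_comp _ _ := rfl

end Coinduction

section DependentProduct

variable {G : Type u} [Group G]

/-- The underlying set of the dependent product `n_* A` of `p : A ⟶ S` along `n : S ⟶ T`: pairs
of a point `base` of `T` and a section of `p` over the fibre of `n` at `base`. -/
structure DepProdSet {A S T : FinGSet G} (n : S ⟶ T) (p : A ⟶ S) : Type u where
  base : T.carrier
  sec : { s : S.carrier // n.hom s = base } → A.carrier
  is_sec : ∀ s, p.hom (sec s) = s.1

theorem DepProdSet.ext_of_forall {A S T : FinGSet G} {n : S ⟶ T} {p : A ⟶ S}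
    {a b : DepProdSet n p} (h : a.base = b.base)
    (h' : ∀ s ha hb, a.sec ⟨s, ha⟩ = b.sec ⟨s, hb⟩) : a = b := by
  obtain ⟨t, σ, hσ⟩ := a
  obtain ⟨t', τ, hτ⟩ := b
  obtain rfl : t = t' := h
  obtain rfl : σ = τ := funext fun s => h' s.1 s.2 s.2
  rfl

/-- `G` acts on `n_* A` by `g (t, σ) = (g t, s ↦ g σ(g⁻¹ s))`. -/
instance depProdAction {A S T : FinGSet G} (n : S ⟶ T) (p : A ⟶ S) :
    MulAction G (DepProdSet n p) where
  smul g a :=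
    { base := g • a.base
      sec := fun s => g • a.sec ⟨g⁻¹ • s.1, by rw [map_smul, s.2, inv_smul_smul]⟩
      is_sec := fun s => by rw [map_smul, a.is_sec, smul_inv_smul] }
  one_smul a := DepProdSet.ext_of_forall (one_smul G a.base) fun s ha hb =>
    (one_smul G _).trans (congrArg a.sec (Subtype.ext (by simp)))
  mul_smul g g' a := DepProdSet.ext_of_forall (mul_smul g g' a.base) fun s ha hb =>
    (mul_smul g g' _).trans (congrArg (fun z => g • g' • a.sec z)
      (Subtype.ext (by simp [mul_smul])))

instance depProdFinite {A S T : FinGSet G} (n : S ⟶ T) (p : A ⟶ S) :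
    Finite (DepProdSet n p) :=
  Finite.of_injective
    (fun a => (⟨a.base, a.sec⟩ : Σ t : T.carrier, { s : S.carrier // n.hom s = t } → A.carrier))
    fun a b h => by
      obtain ⟨t, σ, hσ⟩ := a
      obtain ⟨t', τ, hτ⟩ := b
      obtain ⟨rfl, h2⟩ := Sigma.mk.inj_iff.1 h
      obtain rfl := eq_of_heq h2
      rfl

/-- The dependent product `n_* A`, the value at `p : A ⟶ S` of the right adjoint of pullback
along `n : S ⟶ T`. -/
def depProd {A S T : FinGSet G} (n : S ⟶ T) (p : A ⟶ S) : FinGSet G where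
  carrier := DepProdSet n p

/-- The structure map `n_* A ⟶ T`. -/
def depProdProj {A S T : FinGSet G} (n : S ⟶ T) (p : A ⟶ S) : depProd n p ⟶ T :=
  ⟨{ toFun := fun a : DepProdSet n p => a.base
     map_smul' := fun _ _ => rfl }⟩

end DependentProduct

end FinGSet

/-! Indexing categories -/

/-- An indexing category: a wide, pullback stable, finite coproduct complete subcategory of finite
`G`-sets, given by its class of morphisms. Finite coproduct complete means that a finite coproduct
of `G`-sets, with its inclusions, is also a coproduct in the subcategory. -/
structure IndexingCategory (G : Type u) [Group G] where
  maps : MorphismProperty (FinGSet G)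
  isMultiplicative : maps.IsMultiplicative
  isStableUnderBaseChange : maps.IsStableUnderBaseChange
  inj_mem : ∀ {ι : Type} [Finite ι] {X : ι → FinGSet G} (c : Cofan X), IsColimit c →
    ∀ i, maps (c.inj i)
  desc_mem : ∀ {ι : Type} [Finite ι] {X : ι → FinGSet G} (c : Cofan X), IsColimit c →
    ∀ {Y : FinGSet G} (f : c.pt ⟶ Y), (∀ i, maps (c.inj i ≫ f)) → maps f

namespace IndexingCategory

variable {G : Type u} [Group G]

/-- The `H`-set `X` is `O`-admissible: the canonical map `G ×_H X ⟶ G/H` is in `O`. -/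
def Admissible [Finite G] (O : IndexingCategory G) (H : Subgroup G) (X : FinGSet H) : Prop :=
  O.maps (FinGSet.indProj H X)

/-- The class of maps of `i_H^* O`: the maps `f` of finite `H`-sets with `G ×_H f` in `O`. -/
def restrict [Finite G] (O : IndexingCategory G) (H : Subgroup G) :
    MorphismProperty (FinGSet H) :=
  O.maps.inverseImage (FinGSet.ind H)

/-- The pair `(Om, Oa)` is compatible: for every `n : S ⟶ T` in `Om`, the dependent product along
`n` takes objects over `S` with structure map in `Oa` to objects over `T` with structure map
in `Oa`. -/
def Compatible (Om Oa : IndexingCategory G) : Prop :=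
  ∀ {S T : FinGSet G} (n : S ⟶ T), Om.maps n →
    ∀ {A : FinGSet G} (p : A ⟶ S), Oa.maps p → Oa.maps (FinGSet.depProdProj n p)

end IndexingCategory

/-! Transfer systems -/

/-- A `G`-transfer system: a partial order on the subgroups of `G` that refines inclusion and is
closed under conjugation and under intersection with subgroups. -/
structure TransferSystem (G : Type u) [Group G] where
  rel : Subgroup G → Subgroup G → Prop
  refl : ∀ H, rel H H
  trans : ∀ {L K H}, rel L K → rel K H → rel L H
  antisymm : ∀ {K H}, rel K H → rel H K → K = H
  le : ∀ {K H}, rel K H → K ≤ H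
  conj : ∀ {K H}, rel K H → ∀ g : G, rel (MulAut.conj g • K) (MulAut.conj g • H)
  inter : ∀ {K H}, rel K H → ∀ L : Subgroup G, rel (K ⊓ L) (H ⊓ L)

namespace TransferSystem

variable {G : Type u} [Group G]

/-- The pair of transfer systems `(T₁, T₂)` is compatible. -/
structure Compatible (T₁ T₂ : TransferSystem G) : Prop where
  refines : ∀ {K H : Subgroup G}, T₁.rel K H → T₂.rel K H
  diamond : ∀ {A B C : Subgroup G}, B ≤ A → C ≤ A → T₁.rel B A → T₂.rel (B ⊓ C) B → T₂.rel C A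

/-- The transfer system `T` and the indexing category `O` correspond to each other: `K` is below
`H` in `T` exactly when `K ≤ H` and the orbit `H/K` is `O`-admissible. -/
def Corresponds [Finite G] (T : TransferSystem G) (O : IndexingCategory G) : Prop :=
  ∀ K H : Subgroup G, T.rel K H ↔ K ≤ H ∧ O.Admissible H (FinGSet.orbit H K)

end TransferSystem

/-! ### Finite `G`-sets: coproducts, pullbacks, orbits and stabilizers -/

namespace FinGSet

variable {G : Type u} [Group G]

/-! Everything is reduced to subgroups. Every finite `G`-set is a coproduct of orbits, so whether a
map `f` lies in an indexing category depends only on the inclusions Stab(x) ≤ Stab(f x), through the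
relation "G/K → G/H is in `O`" (`maps_iff_forall_rel`). This relation is the transfer system that
corresponds to `O`.

A point of a dependent product is a point t of the base and a section over the fibre at t. Its
stabilizer consists of the elements of Stab(t) that preserve the image U of the section. Likewise, a
coinduced map α : H → S is encoded by the set U of points [h⁻¹, α(h)] of G ×_K S, and Stab(α) is the
stabilizer of U in L = Stab(f ∘ α). Both closure statements therefore follow from one fact about set
stabilizers, `Compatible.rel_stabilizer_set`. It is proved by induction on |L|: U is split along the
L-orbits of its projection, and the compatibility axiom passes from a proper point stabilizer B < L
to L.

For a compatible pair of indexing categories, the two associated transfer systems are compatible: a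
suitable section gives a point of a dependent product whose stabilizer is exactly C
(`Compatible.diamond`). The first claim is then an instance of the argument for the second. -/

theorem hom_ext {X Y : FinGSet G} {f g : X ⟶ Y} (h : ∀ x, f.hom x = g.hom x) : f = g :=
  Hom.ext (MulActionHom.ext h)

theorem mono_of_injective {X Y : FinGSet G} (f : X ⟶ Y) (hf : Function.Injective f.hom) :
    Mono f :=
  ⟨fun _ _ e => hom_ext fun x => hf (congrArg (fun k => Hom.hom k x) e)⟩

/-- A jointly bijective finite family of maps exhibits its target as a coproduct. -/
noncomputable def cofanIsColimitOfBijective {ι : Type} {X : ι → FinGSet G} (c : Cofan X)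
    (hc : Function.Bijective (fun p : Σ i, (X i).carrier => (c.inj p.1).hom p.2)) :
    IsColimit c :=
  Cofan.IsColimit.mk c
    (fun s =>
      ⟨{ toFun := fun y =>
          (s.inj ((Equiv.ofBijective _ hc).symm y).1).hom ((Equiv.ofBijective _ hc).symm y).2
         map_smul' := fun g y => by
          obtain ⟨⟨i, x⟩, rfl⟩ := (Equiv.ofBijective _ hc).surjective y
          have : g • (Equiv.ofBijective _ hc) ⟨i, x⟩ = (Equiv.ofBijective _ hc) ⟨i, g • x⟩ :=
            (map_smul (c.inj i).hom g x).symm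
          rw [this, Equiv.symm_apply_apply, Equiv.symm_apply_apply]
          exact map_smul (s.inj i).hom g x }⟩)
    (fun s i => hom_ext fun x => by
      change (s.inj ((Equiv.ofBijective _ hc).symm ((Equiv.ofBijective _ hc) ⟨i, x⟩)).1).hom
        ((Equiv.ofBijective _ hc).symm ((Equiv.ofBijective _ hc) ⟨i, x⟩)).2 = _
      rw [Equiv.symm_apply_apply])
    (fun s m hm => hom_ext fun y => by
      obtain ⟨⟨i, x⟩, rfl⟩ := (Equiv.ofBijective _ hc).surjective y
      change m.hom ((c.inj i).hom x) =
        (s.inj ((Equiv.ofBijective _ hc).symm ((Equiv.ofBijective _ hc) ⟨i, x⟩)).1).hom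
        ((Equiv.ofBijective _ hc).symm ((Equiv.ofBijective _ hc) ⟨i, x⟩)).2
      rw [Equiv.symm_apply_apply, ← hm i]
      rfl)

/-- The complement of the image of a map of finite `G`-sets. -/
def rangeCompl {X Y : FinGSet G} (f : X ⟶ Y) : FinGSet G where
  carrier := { y : Y.carrier // y ∉ Set.range f.hom }
  action :=
    { smul := fun g y => ⟨g • y.1, fun ⟨x, hx⟩ => y.2 ⟨g⁻¹ • x, by
        rw [map_smul, hx, inv_smul_smul]⟩⟩
      one_smul := fun y => Subtype.ext (one_smul G y.1)
      mul_smul := fun g h y => Subtype.ext (mul_smul g h y.1) }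

/-- The inclusion of the complement of the image. -/
def rangeComplInclusion {X Y : FinGSet G} (f : X ⟶ Y) : rangeCompl f ⟶ Y :=
  ⟨{ toFun := Subtype.val
     map_smul' := fun _ _ => rfl }⟩

/-- The fibre product of finite `G`-sets. -/
def fibreProd {X Y Z : FinGSet G} (f : X ⟶ Z) (g : Y ⟶ Z) : FinGSet G where
  carrier := { q : X.carrier × Y.carrier // f.hom q.1 = g.hom q.2 }
  action :=
    { smul := fun a q => ⟨(a • q.1.1, a • q.1.2), by rw [map_smul, map_smul, q.2]⟩
      one_smul := fun q => Subtype.ext (one_smul G q.1)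
      mul_smul := fun a b q => Subtype.ext (mul_smul a b q.1) }

/-- The first projection of the fibre product. -/
def fibreProdFst {X Y Z : FinGSet G} (f : X ⟶ Z) (g : Y ⟶ Z) : fibreProd f g ⟶ X :=
  ⟨{ toFun := fun q => q.1.1
     map_smul' := fun _ _ => rfl }⟩

/-- The second projection of the fibre product. -/
def fibreProdSnd {X Y Z : FinGSet G} (f : X ⟶ Z) (g : Y ⟶ Z) : fibreProd f g ⟶ Y :=
  ⟨{ toFun := fun q => q.1.2
     map_smul' := fun _ _ => rfl }⟩

theorem isPullback_fibreProd {X Y Z : FinGSet G} (f : X ⟶ Z) (g : Y ⟶ Z) :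
    IsPullback (fibreProdFst f g) (fibreProdSnd f g) f g :=
  ⟨⟨hom_ext fun q => q.2⟩, ⟨PullbackCone.IsLimit.mk _
    (fun s => ⟨{ toFun := fun w => ⟨(s.fst.hom w, s.snd.hom w),
                   congrArg (fun k => Hom.hom k w) s.condition⟩
                 map_smul' := fun a w => Subtype.ext (Prod.ext (map_smul s.fst.hom a w)
                   (map_smul s.snd.hom a w)) }⟩)
    (fun _ => rfl) (fun _ => rfl)
    (fun _ _ h1 h2 => hom_ext fun w => Subtype.ext (Prod.ext
      (congrArg (fun k => Hom.hom k w) h1) (congrArg (fun k => Hom.hom k w) h2)))⟩⟩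

theorem stabilizer_le {X Y : FinGSet G} (f : X ⟶ Y) (x : X.carrier) :
    MulAction.stabilizer G x ≤ MulAction.stabilizer G (f.hom x) := fun g hg => by
  rw [MulAction.mem_stabilizer_iff] at hg ⊢
  rw [← map_smul, hg]

/-- The inclusion of the orbit of a point. -/
def orbitInclusion [Finite G] {X : FinGSet G} (x : X.carrier) :
    coset (MulAction.stabilizer G x) ⟶ X :=
  ⟨{ toFun := MulAction.ofQuotientStabilizer G x
     map_smul' := MulAction.ofQuotientStabilizer_smul G x }⟩

theorem orbitInclusion_injective [Finite G] {X : FinGSet G} (x : X.carrier) :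
    Function.Injective (orbitInclusion x).hom :=
  MulAction.injective_ofQuotientStabilizer G x

/-- The canonical map `G/K ⟶ G/H` for `K ≤ H`. -/
def cosetMap [Finite G] {K H : Subgroup G} (h : K ≤ H) : coset K ⟶ coset H :=
  ⟨{ toFun := Subgroup.quotientMapOfLE h
     map_smul' := by
      rintro g ⟨x⟩
      rfl }⟩

theorem cosetMap_comp_orbitInclusion [Finite G] {X Y : FinGSet G} (f : X ⟶ Y) (x : X.carrier) :
    cosetMap (stabilizer_le f x) ≫ orbitInclusion (f.hom x) = orbitInclusion x ≫ f :=
  hom_ext (by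
    rintro ⟨g⟩
    exact (map_smul f.hom g x).symm)

theorem stabilizer_smul {X : FinGSet G} (g : G) (x : X.carrier) :
    MulAction.stabilizer G (g • x) = MulAut.conj g • MulAction.stabilizer G x :=
  MulAction.stabilizer_smul_eq_stabilizer_map_conj g x

theorem stabilizer_mk (H : Subgroup G) (g : G) :
    MulAction.stabilizer G (g : G ⧸ H) = MulAut.conj g • H := by
  have : (g : G ⧸ H) = g • ((1 : G) : G ⧸ H) := by
    rw [MulAction.Quotient.smul_coe, smul_eq_mul, mul_one]
  rw [this, MulAction.stabilizer_smul_eq_stabilizer_map_conj, MulAction.stabilizer_quotient]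
  rfl

/-- The class of `(g, x)` in `G ×_H X`. -/
def indMk [Finite G] {H : Subgroup G} {X : FinGSet H} (g : G) (x : X.carrier) :
    ((ind H).obj X).carrier :=
  Quotient.mk (indSetoid H X) (g, x)

section IndMk

variable [Finite G] {H : Subgroup G} {X Y : FinGSet H}

theorem exists_indMk_eq (q : ((ind H).obj X).carrier) : ∃ g x, indMk g x = q := by
  obtain ⟨g, x⟩ := q
  exact ⟨g, x, rfl⟩

theorem indMk_eq_indMk_iff {g g' : G} {x x' : X.carrier} :
    indMk g x = indMk g' x' ↔ ∃ h : H, g' = g * (h : G)⁻¹ ∧ x' = h • x :=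
  Quotient.eq

theorem smul_indMk (a g : G) (x : X.carrier) : a • indMk g x = indMk (a * g) x := rfl

theorem ind_map_indMk (f : X ⟶ Y) (g : G) (x : X.carrier) :
    ((ind H).map f).hom (indMk g x) = indMk g (f.hom x) := rfl

theorem indProj_indMk (g : G) (x : X.carrier) :
    (indProj H X).hom (indMk g x) = (g : G ⧸ H) := rfl

/-- Carries the stabilizer criterion for `G`-maps over to induced maps, hence to `restrict` and
`Admissible`. -/
theorem stabilizer_indMk (g : G) (x : X.carrier) :
    MulAction.stabilizer G (indMk g x) =
      MulAut.conj g • (MulAction.stabilizer H x).map H.subtype := by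
  have e : indMk g x = g • indMk 1 x := by rw [smul_indMk, mul_one]
  rw [e, stabilizer_smul]
  congr 1
  ext y
  rw [MulAction.mem_stabilizer_iff, Subgroup.mem_map, smul_indMk, indMk_eq_indMk_iff]
  constructor
  · rintro ⟨h, h1, h2⟩
    refine ⟨h, h2.symm, ?_⟩
    rw [mul_one, eq_comm, mul_inv_eq_one] at h1
    exact h1.symm
  · rintro ⟨h, h1, rfl⟩
    exact ⟨h, by simp, (MulAction.mem_stabilizer_iff.1 h1).symm⟩

end IndMk

theorem stabilizer_orbit_map [Finite G] {H K : Subgroup G} (hKH : K ≤ H) (h : H) :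
    (MulAction.stabilizer H (h : H ⧸ K.subgroupOf H)).map H.subtype =
      MulAut.conj (h : G) • K := by
  rw [stabilizer_mk]
  ext y
  simp only [Subgroup.mem_map, Subgroup.mem_pointwise_smul_iff_inv_smul_mem,
    Subgroup.mem_subgroupOf, Subgroup.coe_subtype]
  constructor
  · rintro ⟨x, hx, rfl⟩
    simpa [← map_inv] using hx
  · intro hy
    have hy' : y ∈ H := by
      have := H.mul_mem (H.mul_mem h.2 (hKH hy)) (H.inv_mem h.2)
      simpa [← map_inv, mul_assoc] using this
    exact ⟨⟨y, hy'⟩, by simpa [← map_inv] using hy, rfl⟩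

end FinGSet

/-! ### Indexing categories are determined by stabilizers -/

namespace IndexingCategory

open FinGSet

variable {G : Type u} [Group G]

/-- An injection is a coproduct inclusion: its target is the disjoint union of the image and the
complement of the image. -/
theorem maps_of_injective (O : IndexingCategory G) {X Y : FinGSet G} (f : X ⟶ Y)
    (hf : Function.Injective f.hom) : O.maps f := by
  let c : Cofan (fun b : Bool => cond b X (rangeCompl f)) :=
    Cofan.mk Y (fun b => match b with
      | true => f
      | false => rangeComplInclusion f)
  refine O.inj_mem c (cofanIsColimitOfBijective c ⟨?_, ?_⟩) true
  · rintro ⟨_ | _, x⟩ ⟨_ | _, y⟩ h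
    · exact congrArg (Sigma.mk false) (Subtype.ext h)
    · exact absurd ⟨y, h.symm⟩ x.2
    · exact absurd ⟨x, h⟩ y.2
    · exact congrArg (Sigma.mk true) (hf h)
  · intro y
    by_cases hy : y ∈ Set.range f.hom
    · obtain ⟨x, rfl⟩ := hy
      exact ⟨⟨true, x⟩, rfl⟩
    · exact ⟨⟨false, ⟨y, hy⟩⟩, rfl⟩

theorem maps_comp (O : IndexingCategory G) {X Y Z : FinGSet G} {f : X ⟶ Y} {g : Y ⟶ Z}
    (hf : O.maps f) (hg : O.maps g) : O.maps (f ≫ g) :=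
  have := O.isMultiplicative
  O.maps.comp_mem f g hf hg

/-- Since `g` is mono, `f` is the base change of `f ≫ g` along `g`. -/
theorem maps_of_comp_mono (O : IndexingCategory G) {X Y Z : FinGSet G} (f : X ⟶ Y) (g : Y ⟶ Z)
    [Mono g] (h : O.maps (f ≫ g)) : O.maps f := by
  have := O.isStableUnderBaseChange
  refine MorphismProperty.of_isPullback (P := O.maps) (f' := 𝟙 X) (g' := f) (f := g)
    (g := f ≫ g) ?_ h
  refine ⟨⟨by simp⟩, ⟨PullbackCone.IsLimit.mk _ (fun s => s.fst) (fun s => by simp)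
    (fun s => ?_) (fun s m h1 _ => by simpa using h1)⟩⟩
  rw [← cancel_mono g]
  simpa using s.condition

/-- The relation on subgroups defined by an indexing category. -/
def rel [Finite G] (O : IndexingCategory G) (K H : Subgroup G) : Prop :=
  ∃ h : K ≤ H, O.maps (cosetMap h)

/-- Membership in an indexing category is detected on stabilizers. -/
theorem maps_iff_forall_rel [Finite G] (O : IndexingCategory G) {X Y : FinGSet G} (f : X ⟶ Y) :
    O.maps f ↔ ∀ x, O.rel (MulAction.stabilizer G x) (MulAction.stabilizer G (f.hom x)) := by
  constructor
  -- The composite G/Stab(x) → X → Y factors through the orbit of f x, whose inclusion is mono and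
  -- can be cancelled.
  · intro hf x
    refine ⟨stabilizer_le f x, ?_⟩
    have := mono_of_injective _ (orbitInclusion_injective (f.hom x))
    refine O.maps_of_comp_mono _ (orbitInclusion (f.hom x)) ?_
    rw [cosetMap_comp_orbitInclusion]
    exact O.maps_comp (O.maps_of_injective _ (orbitInclusion_injective x)) hf
  · intro h
    -- The orbits live in `Type u`, whereas `desc_mem` needs an index set in `Type`; hence the
    -- reindexing by `Fin n`.
    obtain ⟨n, ⟨e⟩⟩ := Finite.exists_equiv_fin (MulAction.orbitRel.Quotient G X.carrier)
    let r : Fin n → X.carrier := fun i => (e.symm i).out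
    let c : Cofan (fun i => coset (MulAction.stabilizer G (r i))) :=
      Cofan.mk X (fun i => orbitInclusion (r i))
    have hr : ∀ i (q : (coset (MulAction.stabilizer G (r i))).carrier),
        (Quotient.mk (MulAction.orbitRel G X.carrier) ((orbitInclusion (r i)).hom q)) =
          e.symm i := by
      rintro i ⟨g⟩
      refine Eq.trans (Quotient.sound ?_) (Quotient.out_eq (e.symm i))
      exact ⟨g, rfl⟩
    refine O.desc_mem c (cofanIsColimitOfBijective c ⟨?_, ?_⟩) f fun i => ?_
    · rintro ⟨i, q⟩ ⟨j, q'⟩ hq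
      change (orbitInclusion (r i)).hom q = (orbitInclusion (r j)).hom q' at hq
      obtain rfl : i = j := e.symm.injective (by rw [← hr i q, ← hr j q', hq])
      exact congrArg (Sigma.mk i) (orbitInclusion_injective _ hq)
    · intro x
      obtain ⟨g, hg⟩ : x ∈ MulAction.orbit G (r (e (Quotient.mk _ x))) := by
        have : (MulAction.orbitRel G X.carrier) x (r (e (Quotient.mk _ x))) :=
          Quotient.exact (by simp [r])
        exact this
      exact ⟨⟨e (Quotient.mk _ x), QuotientGroup.mk g⟩, hg⟩
    · change O.maps (orbitInclusion (r i) ≫ f)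
      rw [← cosetMap_comp_orbitInclusion]
      exact O.maps_comp (h (r i)).2 (O.maps_of_injective _ (orbitInclusion_injective _))

theorem rel.conj [Finite G] {O : IndexingCategory G} {K H : Subgroup G} (h : O.rel K H) (g : G) :
    O.rel (MulAut.conj g • K) (MulAut.conj g • H) := by
  have := (O.maps_iff_forall_rel _).1 h.2 (QuotientGroup.mk g)
  change O.rel (MulAction.stabilizer G (g : G ⧸ K)) (MulAction.stabilizer G (g : G ⧸ H)) at this
  rwa [stabilizer_mk, stabilizer_mk] at this

theorem rel_conj_iff [Finite G] {O : IndexingCategory G} {K H : Subgroup G} (g : G) :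
    O.rel (MulAut.conj g • K) (MulAut.conj g • H) ↔ O.rel K H :=
  ⟨fun h => by simpa [smul_smul, ← map_mul] using h.conj g⁻¹, fun h => h.conj g⟩

/-- Base change of G/K → G/H along G/(H ∩ L) → G/H: the pair of base cosets has stabilizer K ∩ (H ∩
L) = K ∩ L in the fibre product. -/
theorem rel.inter [Finite G] {O : IndexingCategory G} {K H : Subgroup G} (h : O.rel K H)
    (L : Subgroup G) : O.rel (K ⊓ L) (H ⊓ L) := by
  have := O.isStableUnderBaseChange
  have hp := MorphismProperty.of_isPullback
    (isPullback_fibreProd (cosetMap h.1) (cosetMap (inf_le_left : H ⊓ L ≤ H))) h.2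
  have hr := (O.maps_iff_forall_rel _).1 hp ⟨(QuotientGroup.mk 1, QuotientGroup.mk 1), rfl⟩
  convert hr using 1
  · ext g
    have e : g ∈ MulAction.stabilizer G (α := (fibreProd (cosetMap h.1)
          (cosetMap (inf_le_left : H ⊓ L ≤ H))).carrier)
        ⟨(QuotientGroup.mk 1, QuotientGroup.mk 1), rfl⟩ ↔
        g ∈ MulAction.stabilizer G (QuotientGroup.mk 1 : G ⧸ K) ∧
        g ∈ MulAction.stabilizer G (QuotientGroup.mk 1 : G ⧸ H ⊓ L) :=
      Subtype.ext_iff.trans Prod.ext_iff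
    rw [e, MulAction.stabilizer_quotient, MulAction.stabilizer_quotient]
    exact ⟨fun hg => ⟨hg.1, h.1 hg.1, hg.2⟩, fun hg => ⟨hg.1, hg.2.2⟩⟩
  · exact (MulAction.stabilizer_quotient _).symm

theorem restrict_iff_forall_rel [Finite G] (O : IndexingCategory G) (H : Subgroup G)
    {X Y : FinGSet H} (f : X ⟶ Y) :
    O.restrict H f ↔ ∀ x, O.rel ((MulAction.stabilizer H x).map H.subtype)
      ((MulAction.stabilizer H (f.hom x)).map H.subtype) := by
  refine (O.maps_iff_forall_rel _).trans ⟨fun h x => ?_, fun h q => ?_⟩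
  · have := h (indMk 1 x)
    rwa [ind_map_indMk, stabilizer_indMk, stabilizer_indMk, rel_conj_iff] at this
  · obtain ⟨g, x, rfl⟩ := exists_indMk_eq q
    rw [ind_map_indMk, stabilizer_indMk, stabilizer_indMk]
    exact (h x).conj g

theorem admissible_iff_forall_rel [Finite G] (O : IndexingCategory G) (H : Subgroup G)
    (X : FinGSet H) :
    O.Admissible H X ↔ ∀ x : X.carrier,
      O.rel ((MulAction.stabilizer H x).map H.subtype) H := by
  refine (O.maps_iff_forall_rel _).trans ⟨fun h x => ?_, fun h q => ?_⟩
  · have := h (indMk 1 x)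
    rw [indProj_indMk, stabilizer_indMk] at this
    erw [stabilizer_mk] at this
    rwa [rel_conj_iff] at this
  · obtain ⟨g, x, rfl⟩ := exists_indMk_eq q
    rw [indProj_indMk, stabilizer_indMk]
    erw [stabilizer_mk]
    exact (h x).conj g

/-- The stabilizers of points of H/K are the conjugates hKh⁻¹ with h in H, and such h normalize H,
so all the conditions are conjugate to the one at the base coset. -/
theorem admissible_orbit_iff [Finite G] (O : IndexingCategory G) {K H : Subgroup G}
    (hKH : K ≤ H) : O.Admissible H (orbit H K) ↔ O.rel K H := by
  have hH : ∀ h : H, MulAut.conj (h : G) • H = H := fun h =>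
    Subgroup.conj_smul_eq_self_of_mem h.2
  rw [admissible_iff_forall_rel]
  constructor
  · intro h
    have := h (QuotientGroup.mk 1)
    erw [stabilizer_orbit_map hKH] at this
    simpa using this
  · rintro h ⟨x⟩
    erw [stabilizer_orbit_map hKH]
    have := h.conj (x : G)
    rwa [hH] at this

/-- The transfer system of an indexing category. -/
def transferSystem [Finite G] (O : IndexingCategory G) : TransferSystem G where
  rel := O.rel
  refl H := ⟨le_rfl, O.maps_of_injective _ (by
    rintro ⟨a⟩ ⟨b⟩ h
    exact h)⟩
  trans {L K H} h h' := ⟨h.1.trans h'.1, by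
    have : cosetMap (h.1.trans h'.1) = cosetMap h.1 ≫ cosetMap h'.1 := hom_ext (by
      rintro ⟨a⟩
      rfl)
    rw [this]
    exact O.maps_comp h.2 h'.2⟩
  antisymm h h' := le_antisymm h.1 h'.1
  le h := h.1
  conj h := h.conj
  inter h := h.inter

theorem transferSystem_corresponds [Finite G] (O : IndexingCategory G) :
    O.transferSystem.Corresponds O := fun _ _ =>
  ⟨fun h => ⟨h.1, (O.admissible_orbit_iff h.1).2 h⟩, fun h => (O.admissible_orbit_iff h.1).1 h.2⟩

end IndexingCategory

theorem TransferSystem.Corresponds.rel_iff {G : Type u} [Group G] [Finite G]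
    {T : TransferSystem G} {O : IndexingCategory G} (h : T.Corresponds O) {K H : Subgroup G} :
    T.rel K H ↔ O.rel K H :=
  (h K H).trans (O.transferSystem_corresponds K H).symm

/-! ### Set stabilizers under a compatible pair of transfer systems -/

namespace TransferSystem

variable {G : Type u} [Group G]

/-- Intersecting K → L with K' ≤ L gives K ∩ K' → K', which is then composed with K' → L. -/
theorem rel_inf (T : TransferSystem G) {K K' L : Subgroup G} (h : T.rel K L) (h' : T.rel K' L) :
    T.rel (K ⊓ K') L := by
  have := T.inter h K'
  rw [inf_eq_right.2 (T.le h')] at this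
  exact T.trans this h'

theorem rel_iInf_inf (T : TransferSystem G) {ι : Type*} [Finite ι] (K : ι → Subgroup G)
    (L : Subgroup G) (h : ∀ i, T.rel (K i ⊓ L) L) : T.rel ((⨅ i, K i) ⊓ L) L := by
  have := Fintype.ofFinite ι
  have key : ∀ s : Finset ι, T.rel ((⨅ i ∈ s, K i) ⊓ L) L := fun s => by
    classical
    induction s using Finset.induction_on with
    | empty => simpa using T.refl L
    | insert i s _ ih =>
      rw [Finset.iInf_insert, inf_inf_distrib_right]
      exact T.rel_inf (h i) ih
  simpa using key Finset.univ

/-- If `U` maps injectively under `p` onto an `L`-invariant set, with stabilizers admissible for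
`T₁` in the base and for `T₂` along `p`, then the stabilizer of the set `U` in `L` is admissible
for `T₂`. -/
theorem Compatible.rel_stabilizer_set [Finite G] {T₁ T₂ : TransferSystem G}
    (hT : T₁.Compatible T₂) {A S : Type*} [Finite A] [MulAction G A] [MulAction G S] (p : A → S)
    (hp : ∀ (g : G) a, p (g • a) = g • p a) (L : Subgroup G) (U : Set A) (hU : Set.InjOn p U)
    (hL : ∀ g ∈ L, ∀ a ∈ U, g • p a ∈ p '' U)
    (h₁ : ∀ a ∈ U, T₁.rel (MulAction.stabilizer G (p a) ⊓ L) L)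
    (h₂ : ∀ a ∈ U, T₂.rel (MulAction.stabilizer G a ⊓ L) (MulAction.stabilizer G (p a) ⊓ L)) :
    T₂.rel (MulAction.stabilizer G U ⊓ L) L := by
  induction hn : Nat.card L using Nat.strong_induction_on generalizing L U with
  | _ n ih =>
  -- The part of U lying over the L-orbit of p a. An element of L preserves U exactly when it
  -- preserves every such part.
  let V : A → Set A := fun a => {b ∈ U | ∃ g ∈ L, p b = g • p a}
  have hV : MulAction.stabilizer G U ⊓ L =
      (⨅ a : U, MulAction.stabilizer G (V a)) ⊓ L := by
    ext g
    simp only [Subgroup.mem_inf, Subgroup.mem_iInf, and_congr_left_iff,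
      MulAction.mem_stabilizer_set]
    refine fun hg => ⟨fun h a b => ?_, fun h b => ⟨fun hb => ?_, fun hb => ?_⟩⟩
    · refine and_congr (h b) ⟨?_, ?_⟩
      · rintro ⟨k, hk, e⟩
        refine ⟨g⁻¹ * k, L.mul_mem (L.inv_mem hg) hk, ?_⟩
        rw [mul_smul, ← e, hp, inv_smul_smul]
      · rintro ⟨k, hk, e⟩
        exact ⟨g * k, L.mul_mem hg hk, by rw [mul_smul, ← e, hp]⟩
    · exact ((h ⟨_, hb⟩ b).1 ⟨hb, 1, L.one_mem, (one_smul G _).symm⟩).1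
    · exact ((h ⟨_, hb⟩ b).2 ⟨hb, 1, L.one_mem, (one_smul G _).symm⟩).1
  rw [hV]
  refine T₂.rel_iInf_inf _ _ fun ⟨a, ha⟩ => ?_
  -- If L fixes p a, injectivity of p on U reduces the part to one point, and `h₂` applies directly.
  by_cases hB : L ≤ MulAction.stabilizer G (p a)
  · have hVa : V a = {a} := by
      ext b
      refine ⟨fun ⟨hb, g, hg, e⟩ => hU hb ha ?_, ?_⟩
      · rw [e]
        exact hB hg
      · rintro rfl
        exact ⟨ha, 1, L.one_mem, (one_smul G _).symm⟩
    have := h₂ a ha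
    rw [inf_eq_right.2 hB] at this
    simpa only [hVa, MulAction.stabilizer_singleton] using this
  · set B := MulAction.stabilizer G (p a) ⊓ L with hBdef
    have hBL : B ≤ L := inf_le_right
    have hcard : Nat.card B < n := by
      rw [← hn]
      refine lt_of_le_of_ne (Subgroup.card_le_of_le hBL) fun e => hB ?_
      rw [← Subgroup.eq_of_le_of_card_ge hBL e.ge]
      exact inf_le_left
    -- The induction hypothesis is applied to the whole part, which may split further into several
    -- pieces over the B-orbits.
    have key := ih _ hcard B (V a) (hU.mono fun b hb => hb.1) ?_ ?_ ?_ rfl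
    · refine hT.diamond hBL inf_le_right (h₁ a ha) ?_
      rwa [inf_comm, inf_assoc, inf_eq_right.2 hBL]
    · rintro g hg b ⟨hb, k, hk, e⟩
      obtain ⟨c, hc, hcb⟩ := hL g (hBL hg) b hb
      exact ⟨c, ⟨hc, g * k, L.mul_mem (hBL hg) hk, by rw [hcb, e, mul_smul]⟩, hcb⟩
    · intro b hb
      have := T₁.inter (h₁ b hb.1) B
      rwa [inf_assoc, inf_eq_right.2 hBL] at this
    · intro b hb
      have := T₂.inter (h₂ b hb.1) B
      rwa [inf_assoc, inf_assoc, inf_eq_right.2 hBL] at this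

end TransferSystem

/-! ### Stabilizers of points of dependent products -/

namespace FinGSet

variable {G : Type u} [Group G]

theorem DepProdSet.mem_stabilizer_iff {A S T : FinGSet G} {n : S ⟶ T} {p : A ⟶ S}
    (a : DepProdSet n p) (g : G) :
    g ∈ MulAction.stabilizer G a ↔ g ∈ MulAction.stabilizer G a.base ∧
      ∀ s hs hs', g • a.sec ⟨s, hs⟩ = a.sec ⟨g • s, hs'⟩ := by
  have sec_congr : ∀ {b c : DepProdSet n p}, b = c → ∀ s hb hc, b.sec ⟨s, hb⟩ = c.sec ⟨s, hc⟩ := by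
    rintro b _ rfl s _ _
    rfl
  have smul_sec : ∀ s hs hs', (g • a).sec ⟨g • s, hs'⟩ = g • a.sec ⟨s, hs⟩ := fun s hs hs' =>
    congrArg (fun z => g • a.sec z) (Subtype.ext (inv_smul_smul g s))
  constructor
  · intro h
    have hb : g • a.base = a.base := congrArg DepProdSet.base h
    refine ⟨hb, fun s hs hs' => ?_⟩
    rw [← smul_sec s hs (hs'.trans hb.symm)]
    exact sec_congr h _ _ _
  · rintro ⟨hb, h⟩
    refine DepProdSet.ext_of_forall hb fun s hs hs' => ?_
    obtain ⟨s, rfl⟩ : ∃ s', s = g • s' := ⟨g⁻¹ • s, (smul_inv_smul g s).symm⟩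
    have hs'' : n.hom s = a.base := by
      rw [map_smul] at hs
      exact smul_left_cancel g hs
    rw [smul_sec s hs'', h s hs'' hs']

/-- A section is determined by its image, because p recovers the argument of each value. -/
theorem DepProdSet.stabilizer_eq {A S T : FinGSet G} {n : S ⟶ T} {p : A ⟶ S}
    (a : DepProdSet n p) :
    MulAction.stabilizer G a =
      MulAction.stabilizer G (Set.range a.sec) ⊓ MulAction.stabilizer G a.base := by
  ext g
  rw [a.mem_stabilizer_iff, Subgroup.mem_inf, and_comm, and_congr_left_iff,
    MulAction.mem_stabilizer_set' (Set.toFinite _)]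
  refine fun hg => ⟨?_, fun h s hs hs' => ?_⟩
  · rintro h _ ⟨⟨s, hs⟩, rfl⟩
    exact ⟨⟨g • s, by rw [map_smul, hs, hg]⟩, (h _ _ _).symm⟩
  · obtain ⟨⟨s', hs''⟩, e⟩ := h ⟨⟨s, hs⟩, rfl⟩
    have := congrArg p.hom e
    rw [map_smul, a.is_sec, a.is_sec] at this
    obtain rfl : s' = g • s := this
    exact e.symm

end FinGSet

open FinGSet

/-! ### Dependent products and coinduction for compatible transfer systems -/

namespace TransferSystem

variable {G : Type u} [Group G] [Finite G] {Tm Ta : TransferSystem G} {Om Oa : IndexingCategory G}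

theorem Corresponds.maps_iff {T : TransferSystem G} {O : IndexingCategory G} (h : T.Corresponds O)
    {X Y : FinGSet G} (f : X ⟶ Y) :
    O.maps f ↔ ∀ x, T.rel (MulAction.stabilizer G x) (MulAction.stabilizer G (f.hom x)) := by
  simp only [h.rel_iff, O.maps_iff_forall_rel]

theorem Compatible.compatible (hm : Tm.Corresponds Om) (ha : Ta.Corresponds Oa)
    (hT : Tm.Compatible Ta) : Om.Compatible Oa := by
  intro S T n hn A p hp
  rw [hm.maps_iff] at hn
  rw [ha.maps_iff] at hp ⊢
  intro (a : DepProdSet n p)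
  have hle : ∀ s : { s : S.carrier // n.hom s = a.base },
      MulAction.stabilizer G s.1 ≤ MulAction.stabilizer G a.base := fun s =>
    (stabilizer_le n s.1).trans (by rw [s.2])
  suffices h : Ta.rel (MulAction.stabilizer G (Set.range a.sec) ⊓ MulAction.stabilizer G a.base)
      (MulAction.stabilizer G a.base) by
    rw [← DepProdSet.stabilizer_eq] at h
    exact h
  refine hT.rel_stabilizer_set p.hom (fun g x => map_smul p.hom g x) _ _ ?_ ?_ ?_ ?_
  · rintro _ ⟨s, rfl⟩ _ ⟨s', rfl⟩ h
    rw [a.is_sec, a.is_sec] at h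
    rw [Subtype.ext h]
  · rintro g hg _ ⟨s, rfl⟩
    refine ⟨_, ⟨⟨g • s.1, by rw [map_smul, s.2, hg]⟩, rfl⟩, ?_⟩
    rw [a.is_sec, a.is_sec]
  · rintro _ ⟨s, rfl⟩
    rw [a.is_sec, inf_eq_left.2 (hle s)]
    have := hn s.1
    rwa [s.2] at this
  · rintro _ ⟨s, rfl⟩
    exact Ta.inter (hp _) _

theorem Compatible.restrict_coind_map (hm : Tm.Corresponds Om) (ha : Ta.Corresponds Oa)
    (hT : Tm.Compatible Ta) {K H : Subgroup G} (hKH : K ≤ H)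
    (hK : Om.Admissible H (FinGSet.orbit H K)) {S T : FinGSet K} (f : S ⟶ T)
    (hf : Oa.restrict K f) : Oa.restrict H ((FinGSet.coind hKH).map f) := by
  have hrel : Tm.rel K H := (hm K H).2 ⟨hKH, hK⟩
  rw [IndexingCategory.restrict_iff_forall_rel]
  intro (α : CoindSet hKH S)
  rw [← ha.rel_iff]
  let β : CoindSet hKH T := ((coind hKH).map f).hom α
  have hβ : ∀ h, β.toFun h = f.hom (α.toFun h) := fun _ => rfl
  have mem_stab : ∀ {R : FinGSet K} (γ : CoindSet hKH R) (x : H),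
      x ∈ MulAction.stabilizer H γ ↔ ∀ h, γ.toFun (h * x) = γ.toFun h := fun γ x =>
    CoindSet.ext_iff.trans funext_iff
  have hpt : ∀ {R : FinGSet K} (γ : CoindSet hKH R) (h h' : H) (x : G),
      x • indMk (h : G)⁻¹ (γ.toFun h) = indMk (h' : G)⁻¹ (γ.toFun h') ↔
      ∃ k : K, (h' : G) * x = k * h ∧ γ.toFun h' = k • γ.toFun h := by
    intro R γ h h' x
    rw [smul_indMk, indMk_eq_indMk_iff]
    refine exists_congr fun k => and_congr_left fun _ => ?_
    rw [inv_eq_iff_eq_inv, mul_inv_rev, mul_inv_rev, inv_inv, inv_inv, ← mul_assoc,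
      eq_mul_inv_iff_mul_eq]
  have hpt' : ∀ {R : FinGSet K} (γ : CoindSet hKH R), ∀ x ∈ MulAction.stabilizer H γ, ∀ h : H,
      (x : G) • indMk (h : G)⁻¹ (γ.toFun h) =
        indMk ((h * x⁻¹ : H) : G)⁻¹ (γ.toFun (h * x⁻¹)) := by
    intro R γ x hx h
    rw [hpt]
    refine ⟨1, by simp, ?_⟩
    rw [one_smul, (mem_stab γ _).1 (inv_mem hx)]
  -- The image of α viewed as a section of G ×_K S → G/K over the fibre of G/K → G/H at the base
  -- coset. By equivariance of α, the point [h⁻¹, α(h)] depends only on the coset Kh.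
  let U : Set ((ind K).obj S).carrier := Set.range fun h : H => indMk (h : G)⁻¹ (α.toFun h)
  change Ta.rel ((MulAction.stabilizer H α).map H.subtype)
    ((MulAction.stabilizer H β).map H.subtype)
  set L := (MulAction.stabilizer H β).map H.subtype with hL
  have hLH : L ≤ H := Subgroup.map_subtype_le _
  have hU : (MulAction.stabilizer H α).map H.subtype = MulAction.stabilizer G U ⊓ L := by
    ext x
    rw [Subgroup.mem_inf, MulAction.mem_stabilizer_set' (Set.toFinite _)]
    constructor
    · rintro ⟨x, hx, rfl⟩
      refine ⟨?_, ⟨x, stabilizer_le ((coind hKH).map f) α hx, rfl⟩⟩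
      rintro _ ⟨h, rfl⟩
      exact ⟨h * x⁻¹, (hpt' α x hx h).symm⟩
    · rintro ⟨h, ⟨x, -, rfl⟩⟩
      refine ⟨x, ?_, rfl⟩
      rw [SetLike.mem_coe, mem_stab]
      intro y
      obtain ⟨h', e⟩ := h ⟨y * x, rfl⟩
      obtain ⟨k, hk, hk'⟩ := (hpt α (y * x) h' x).1 e.symm
      have hy : h' = Subgroup.inclusion hKH k * y := Subtype.ext (by
        simpa [← mul_assoc] using hk)
      rw [hy, α.map_mul] at hk'
      exact (smul_left_cancel k hk').symm
  rw [hU]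
  refine hT.rel_stabilizer_set ((ind K).map f).hom (fun g x => map_smul _ g x) _ _ ?_ ?_ ?_ ?_
  · rintro _ ⟨h, rfl⟩ _ ⟨h', rfl⟩ e
    obtain ⟨k, hk, -⟩ := (hpt β h h' 1).1 (by rw [one_smul]; exact e)
    have hy : h' = Subgroup.inclusion hKH k * h := Subtype.ext (by simpa using hk)
    have := (hpt α h h' 1).2 ⟨k, hk, by rw [hy, α.map_mul]⟩
    rwa [one_smul] at this
  · rintro _ ⟨x, hx, rfl⟩ _ ⟨h, rfl⟩
    exact ⟨_, ⟨h * x⁻¹, rfl⟩, (hpt' β x hx h).symm⟩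
  · rintro _ ⟨h, rfl⟩
    -- The stabilizer of [h⁻¹, β(h)] in L is h⁻¹Kh ∩ L: since L fixes β, an element x of L with k =
    -- hxh⁻¹ in K satisfies k β(h) = β(hx) = β(h) automatically.
    have hc := Tm.inter (Tm.conj hrel (h : G)⁻¹) L
    rw [Subgroup.conj_smul_eq_self_of_mem (H.inv_mem h.2), inf_eq_right.2 hLH] at hc
    convert hc using 1
    ext x
    simp only [Subgroup.mem_inf, and_congr_left_iff]
    rintro ⟨x, hx, rfl⟩
    have e := hpt β h h (x : G)
    rw [Subgroup.mem_pointwise_smul_iff_inv_smul_mem]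
    refine e.trans ?_
    constructor
    · rintro ⟨k, hk, -⟩
      have : (h : G) * x * (h : G)⁻¹ ∈ K := by
        rw [hk, mul_inv_cancel_right]
        exact k.2
      simpa [← map_inv] using this
    · intro hk
      have hk' : (h : G) * x * (h : G)⁻¹ ∈ K := by simpa [← map_inv] using hk
      refine ⟨⟨_, hk'⟩, by simp, ?_⟩
      rw [← β.map_mul, ← (mem_stab β x).1 hx h]
      congr 1
      exact Subtype.ext (by simp)
  · rintro _ ⟨h, rfl⟩
    exact Ta.inter ((ha.maps_iff _).1 hf _) _

/-- Coinduction preserves admissible sets. -/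
theorem Compatible.admissible_coind (hm : Tm.Corresponds Om) (ha : Ta.Corresponds Oa)
    (hT : Tm.Compatible Ta) {K H : Subgroup G} (hKH : K ≤ H)
    (hK : Om.Admissible H (FinGSet.orbit H K)) (S : FinGSet K) (hS : Oa.Admissible K S) :
    Oa.Admissible H ((FinGSet.coind hKH).obj S) := by
  -- Admissibility of S is membership of S → pt in the restricted category, and coinduction takes
  -- the point to a point.
  let pt : FinGSet K := { carrier := PUnit }
  let f : S ⟶ pt := ⟨{ toFun := fun _ => PUnit.unit, map_smul' := fun _ _ => rfl }⟩
  have top_map : ∀ L : Subgroup G, (⊤ : Subgroup L).map L.subtype = L := fun L => by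
    rw [← MonoidHom.range_eq_map, Subgroup.range_subtype]
  rw [IndexingCategory.admissible_iff_forall_rel] at hS ⊢
  have hf : Oa.restrict K f := by
    rw [IndexingCategory.restrict_iff_forall_rel]
    intro s
    have : MulAction.stabilizer K (f.hom s) = ⊤ := eq_top_iff.2 fun _ _ => rfl
    rw [this, top_map]
    exact hS s
  intro α
  have := (IndexingCategory.restrict_iff_forall_rel _ _ _).1
    (hT.restrict_coind_map hm ha hKH hK f hf) α
  have ht : MulAction.stabilizer H (((coind hKH).map f).hom α) = ⊤ := eq_top_iff.2 fun _ _ => rfl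
  rwa [ht, top_map] at this

end TransferSystem

/-! ### Compatible indexing categories have compatible transfer systems -/

namespace IndexingCategory

variable {G : Type u} [Group G] [Finite G] {Om Oa : IndexingCategory G}

/-- The dependent product of G/(B ∩ C) ⊔ G/B → G/B along G/B → G/A has a point over the base coset
with stabilizer exactly C. Its section uses the first summand on the C-orbit of the base coset of
G/B and the second elsewhere; the spare copy of G/B makes a section available off that orbit. -/
theorem Compatible.diamond (hO : Om.Compatible Oa) {A B C : Subgroup G}
    (hCA : C ≤ A) (hBA : Om.rel B A) (hBC : Oa.rel (B ⊓ C) B) : Oa.rel C A := by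
  classical
  let X : FinGSet G := { carrier := (G ⧸ (B ⊓ C)) ⊕ (G ⧸ B) }
  let p : X ⟶ coset B :=
    ⟨{ toFun := Sum.elim (cosetMap (inf_le_left : B ⊓ C ≤ B)).hom id
       map_smul' := by
        rintro g (x | x)
        · exact map_smul (cosetMap (inf_le_left : B ⊓ C ≤ B)).hom g x
        · rfl }⟩
  have hp : Oa.maps p := by
    rw [Oa.maps_iff_forall_rel]
    rintro (x | x)
    · have h : MulAction.stabilizer G (Sum.inl x : (G ⧸ (B ⊓ C)) ⊕ (G ⧸ B)) =
          MulAction.stabilizer G x := by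
        ext g
        exact Sum.inl_injective.eq_iff
      change Oa.rel (MulAction.stabilizer G (Sum.inl x : (G ⧸ (B ⊓ C)) ⊕ (G ⧸ B))) _
      rw [h]
      exact (Oa.maps_iff_forall_rel _).1 hBC.2 x
    · have h : MulAction.stabilizer G (Sum.inr x : (G ⧸ (B ⊓ C)) ⊕ (G ⧸ B)) =
          MulAction.stabilizer G x := by
        ext g
        exact Sum.inr_injective.eq_iff
      change Oa.rel (MulAction.stabilizer G (Sum.inr x : (G ⧸ (B ⊓ C)) ⊕ (G ⧸ B)))
        (MulAction.stabilizer G x)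
      rw [h]
      exact Oa.transferSystem.refl _
  -- The choice of c does not matter: if c and c' in C have the same coset modulo B, then c⁻¹c' lies
  -- in B ∩ C.
  let σ : G ⧸ B → (G ⧸ (B ⊓ C)) ⊕ (G ⧸ B) := fun s =>
    if h : ∃ c ∈ C, (c : G ⧸ B) = s then Sum.inl (h.choose : G ⧸ (B ⊓ C)) else Sum.inr s
  have hσ_inl : ∀ c ∈ C, σ (c : G ⧸ B) = Sum.inl (c : G ⧸ (B ⊓ C)) := by
    intro c hc
    have h : ∃ c' ∈ C, (c' : G ⧸ B) = c := ⟨c, hc, rfl⟩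
    have e : σ (c : G ⧸ B) = Sum.inl (h.choose : G ⧸ (B ⊓ C)) := dif_pos h
    rw [e]
    refine congrArg Sum.inl (QuotientGroup.eq.2 ⟨QuotientGroup.eq.1 h.choose_spec.2, ?_⟩)
    exact C.mul_mem (C.inv_mem h.choose_spec.1) hc
  have hσ_inr : ∀ s, (¬ ∃ c ∈ C, (c : G ⧸ B) = s) → σ s = Sum.inr s := fun s h => dif_neg h
  have hpσ : ∀ s, p.hom (σ s) = s := by
    intro s
    by_cases h : ∃ c ∈ C, (c : G ⧸ B) = s
    · obtain ⟨c, hc, rfl⟩ := h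
      rw [hσ_inl c hc]
      rfl
    · rw [hσ_inr s h]
      rfl
  have hσ_smul : ∀ c ∈ C, ∀ s, c • σ s = σ (c • s) := by
    intro c hc s
    by_cases h : ∃ c ∈ C, (c : G ⧸ B) = s
    · obtain ⟨d, hd, rfl⟩ := h
      rw [hσ_inl d hd, MulAction.Quotient.smul_coe, smul_eq_mul, hσ_inl _ (C.mul_mem hc hd)]
      rfl
    · rw [hσ_inr s h, hσ_inr (c • s)]
      · rfl
      · rintro ⟨d, hd, e⟩
        refine h ⟨c⁻¹ * d, C.mul_mem (C.inv_mem hc) hd, ?_⟩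
        rw [← smul_eq_mul, ← MulAction.Quotient.smul_coe, e, inv_smul_smul]
  let a : DepProdSet (cosetMap hBA.1) p :=
    { base := ((1 : G) : G ⧸ A)
      sec := fun s => σ s.1
      is_sec := fun s => hpσ s.1 }
  have hbase : MulAction.stabilizer G a.base = A := MulAction.stabilizer_quotient A
  have hstab : MulAction.stabilizer G a = C := by
    ext g
    rw [a.mem_stabilizer_iff, hbase]
    constructor
    · rintro ⟨hg, h⟩
      -- The value at the base coset already forces g into C: it puts g⁻¹B in the C-orbit, and then
      -- g⁻¹(B ∩ C) = c(B ∩ C) for some c in C.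
      have e : g⁻¹ • σ ((1 : G) : G ⧸ B) = σ (g⁻¹ • ((1 : G) : G ⧸ B)) := by
        have hg1 : (cosetMap hBA.1).hom ((g⁻¹ : G) : G ⧸ B) = a.base :=
          QuotientGroup.eq.2 (by simpa using hg)
        have := h ((g⁻¹ : G) : G ⧸ B) hg1 ?_
        · change g • σ ((g⁻¹ : G) : G ⧸ B) = σ (g • ((g⁻¹ : G) : G ⧸ B)) at this
          rw [inv_smul_eq_iff]
          simp only [MulAction.Quotient.smul_coe, smul_eq_mul, mul_inv_cancel, mul_one] at this ⊢
          exact this.symm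
        · exact congrArg (QuotientGroup.mk : G → G ⧸ A) (mul_inv_cancel g)
      by_cases hc : ∃ c ∈ C, (c : G ⧸ B) = g⁻¹ • ((1 : G) : G ⧸ B)
      · obtain ⟨c, hc, hcg⟩ := hc
        rw [← hcg, hσ_inl 1 C.one_mem, hσ_inl c hc] at e
        have := (QuotientGroup.eq.1 (Sum.inl_injective e)).2
        simpa [C.mul_mem_cancel_right hc] using this
      · rw [hσ_inl 1 C.one_mem, hσ_inr _ hc] at e
        cases e
    · exact fun hg => ⟨hCA hg, fun s _ _ => hσ_smul g hg s⟩
  have := (Oa.maps_iff_forall_rel _).1 (hO _ hBA.2 p hp) a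
  change Oa.rel (MulAction.stabilizer G a) (MulAction.stabilizer G a.base) at this
  rwa [hstab, hbase] at this

theorem Compatible.transferSystem (hO : Om.Compatible Oa) :
    Om.transferSystem.Compatible Oa.transferSystem where
  -- The case C = B, where the condition on B ∩ C is reflexivity.
  refines h := hO.diamond h.1 h (by
    rw [inf_idem]
    exact Oa.transferSystem.refl _)
  diamond _ hC h h' := hO.diamond hC h h'

end IndexingCategory

theorem corollary4 {G : Type u} [Group G] [Finite G] (Om Oa : IndexingCategory G) :
    (Om.Compatible Oa →
      ∀ {K H : Subgroup G} (hKH : K ≤ H), Om.Admissible H (FinGSet.orbit H K) →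
        ∀ {S T : FinGSet K} (f : S ⟶ T),
          Oa.restrict K f → Oa.restrict H ((FinGSet.coind hKH).map f)) ∧
    (∀ Tm Ta : TransferSystem G, Tm.Corresponds Om → Ta.Corresponds Oa → Tm.Compatible Ta →
      (∀ {K H : Subgroup G} (hKH : K ≤ H), Om.Admissible H (FinGSet.orbit H K) →
        ∀ {S T : FinGSet K} (f : S ⟶ T),
          Oa.restrict K f → Oa.restrict H ((FinGSet.coind hKH).map f)) ∧
      (∀ {K H : Subgroup G} (hKH : K ≤ H), Om.Admissible H (FinGSet.orbit H K) →
        ∀ S : FinGSet K, Oa.Admissible K S → Oa.Admissible H ((FinGSet.coind hKH).obj S)) ∧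
      Om.Compatible Oa) :=
  ⟨fun hO _ _ hKH hK _ _ f hf => hO.transferSystem.restrict_coind_map
      Om.transferSystem_corresponds Oa.transferSystem_corresponds hKH hK f hf,
    fun _ _ hm ha hT => ⟨fun hKH hK _ _ f hf => hT.restrict_coind_map hm ha hKH hK f hf,
      fun hKH hK S hS => hT.admissible_coind hm ha hKH hK S hS,
      hT.compatible hm ha⟩⟩
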